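/- Let $g_2=1$, $g_3=0$. There is a lattice $\Lambda\subset\mathbb{C}$ with these invariants, that is, with $60\sum_{0\ne\lambda\in\Lambda}\lambda^{-4}=1$ and $140\sum_{0\ne\lambda\in\Lambda}\lambda^{-6}=0$, and for some $r>0$ the initial value problem $$s'=c^3,\qquad c'=-s^3,\qquad s(0)=0,\quad c(0)=1$$ has a holomorphic solution pair $(s,c)$ on the disc $|z|<r$. Let $\Lambda$ be any lattice with these invariants and $\wp$ its Weierstrass function. Then $(\wp^2-\tfrac14)/(\wp^2+\tfrac14)$ is an elliptic function, meromorphic on $\mathbb{C}$ and with every element of $\Lambda$ as a period. If $(s,c)$ is a holomorphic solution of the initial value problem on a connected open set $U\ni 0$ (in particular, on a disc about $0$), then the square $C=c^2$ satisfies $$C=\frac{\wp^2-\frac14}{\wp^2+\frac14}\quad\text{on } U:$$ at every $z\in U\setminus\Lambda$ one has $\wp(z)^2+\tfrac14\neq 0$ and the equality holds at $z$; at every $z\in U\cap\Lambda$ (in particular at $z=0$) the right side has a removable singularity with limit $C(z)$. Thus $c^2$ extends to this elliptic function. -/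

import Mathlib

/-- `s` and `c` are holomorphic on the open set `U`, which contains `0`, and solve there the
initial value problem `s' = c ^ 3`, `c' = -s ^ 3`, `s 0 = 0`, `c 0 = 1`. -/
structure IsSolutionIVP (U : Set ℂ) (s c : ℂ → ℂ) : Prop where
  isOpen : IsOpen U
  zero_mem : (0 : ℂ) ∈ U
  hasDerivAt_s : ∀ z ∈ U, HasDerivAt s (c z ^ 3) z
  hasDerivAt_c : ∀ z ∈ U, HasDerivAt c (-(s z ^ 3)) z
  s_zero : s 0 = 0
  c_zero : c 0 = 1

/-- `f` is an elliptic function with respect to the period lattice of `L`: it is meromorphic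
on `ℂ` and every element of the lattice is a period. -/
structure IsElliptic (L : PeriodPair) (f : ℂ → ℂ) : Prop where
  meromorphic : Meromorphic f
  periodic : ∀ l ∈ L.lattice, ∀ z : ℂ, f (z + l) = f z

/-- The function `(℘ ^ 2 - 1 / 4) / (℘ ^ 2 + 1 / 4)`, where `℘` is the Weierstrass function of the
lattice of `L`. Its values at the lattice points (poles of `℘`) and at the zeros of the
denominator are conventional. -/
noncomputable def weierstrassQuotient (L : PeriodPair) (z : ℂ) : ℂ :=
  (L.weierstrassP z ^ 2 - 1 / 4) / (L.weierstrassP z ^ 2 + 1 / 4)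

/-! The squares `C = c ^ 2` and `S = s ^ 2` lie on the circle `C ^ 2 + S ^ 2 = 1`, and the
coordinate `v = 2 * S / (1 + C)` on it satisfies `v' ^ 2 = 4 * v - v ^ 3`. So does `1 / ℘` when
`g₂ = 1` and `g₃ = 0`. A nonconstant solution of `f' ^ 2 = P (f)` also solves `f'' = P' (f) / 2`,
hence is determined by its value and derivative at one point; as `v` and `1 / ℘` both vanish to
second order at `0`, they agree near `0`. Inverting the coordinate gives
`C = (4 - v ^ 2) / (4 + v ^ 2)`, which is the asserted formula near `0`, and the identity theorem
for meromorphic functions carries it over to `U`.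

The lattice `ℤ[i]` has `g₃ = 0` because multiplication by `i` preserves it, and then `g₂ ≠ 0` since
`f' ^ 2 = 4 * f ^ 3` has no nonconstant solution with a critical point; scaling achieves `g₂ = 1`.
-/

open Complex Filter Topology

section HolomorphicODE

variable {z₀ : ℂ}

section Uniqueness

variable {E : Type*} [NormedAddCommGroup E] [NormedSpace ℂ E] [CompleteSpace E] {f g : ℂ → E}
  {v : E → E}

theorem eventuallyEq_of_deriv_eq (hv : ContDiffAt ℂ 1 v (f z₀)) (hf : AnalyticAt ℂ f z₀)
    (hg : AnalyticAt ℂ g z₀) (hdf : ∀ᶠ z in 𝓝 z₀, deriv f z = v (f z))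
    (hdg : ∀ᶠ z in 𝓝 z₀, deriv g z = v (g z)) (h₀ : f z₀ = g z₀) : f =ᶠ[𝓝 z₀] g := by
  obtain ⟨K, S, hS, hK⟩ := hv.exists_lipschitzOnWith
  have hγ : ContinuousAt (fun t : ℝ ↦ z₀ + t) 0 := by fun_prop
  have hγ₀ : Tendsto (fun t : ℝ ↦ z₀ + t) (𝓝 0) (𝓝 z₀) := by simpa using hγ.tendsto
  have solves {φ : ℂ → E} (hφ : AnalyticAt ℂ φ z₀) (hdφ : ∀ᶠ z in 𝓝 z₀, deriv φ z = v (φ z))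
      (hφS : S ∈ 𝓝 (φ z₀)) : ∀ᶠ t : ℝ in 𝓝 0,
        HasDerivAt (fun t : ℝ ↦ φ (z₀ + t)) (v (φ (z₀ + t))) t ∧ φ (z₀ + t) ∈ S := by
    filter_upwards [hγ₀.eventually hφ.eventually_analyticAt, hγ₀.eventually hdφ,
      hγ₀.eventually (hφ.continuousAt.eventually_mem hφS)] with t han hd hmem
    have hline : HasDerivAt (fun t : ℝ ↦ z₀ + t) 1 t :=
      ((hasDerivAt_id t).ofReal_comp).const_add z₀
    have hcomp := HasDerivAt.scomp (h := fun t : ℝ ↦ z₀ + t) t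
      han.differentiableAt.hasDerivAt hline
    rw [one_smul, hd] at hcomp
    exact ⟨hcomp, hmem⟩
  have hreal : (fun t : ℝ ↦ f (z₀ + t)) =ᶠ[𝓝 0] fun t : ℝ ↦ g (z₀ + t) :=
    ODE_solution_unique_of_eventually (v := fun _ ↦ v) (s := fun _ ↦ S) (.of_forall fun _ ↦ hK)
      (solves hf hdf hS) (solves hg hdg (h₀ ▸ hS)) (by simpa using h₀)
  have hγne : Tendsto (fun t : ℝ ↦ z₀ + t) (𝓝[≠] 0) (𝓝[≠] z₀) :=
    tendsto_nhdsWithin_iff.mpr ⟨hγ₀.mono_left nhdsWithin_le_nhds, by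
      filter_upwards [self_mem_nhdsWithin] with t ht using by simpa using ht⟩
  exact (hf.frequently_eq_iff_eventually_eq hg).mp
    (hγne.frequently (hreal.filter_mono nhdsWithin_le_nhds).frequently)

theorem eventuallyEq_of_deriv_deriv_eq (hv : ContDiffAt ℂ 1 v (f z₀))
    (hf : AnalyticAt ℂ f z₀) (hg : AnalyticAt ℂ g z₀)
    (hdf : ∀ᶠ z in 𝓝 z₀, deriv (deriv f) z = v (f z))
    (hdg : ∀ᶠ z in 𝓝 z₀, deriv (deriv g) z = v (g z))
    (h₀ : f z₀ = g z₀) (h₁ : deriv f z₀ = deriv g z₀) : f =ᶠ[𝓝 z₀] g := by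
  have solves {φ : ℂ → E} (hφ : AnalyticAt ℂ φ z₀)
      (hdφ : ∀ᶠ z in 𝓝 z₀, deriv (deriv φ) z = v (φ z)) :
      ∀ᶠ z in 𝓝 z₀, deriv (fun z ↦ (φ z, deriv φ z)) z = (deriv φ z, v (φ z)) := by
    filter_upwards [hφ.eventually_analyticAt, hdφ] with z hz hd
    rw [← hd]
    exact (hz.differentiableAt.hasDerivAt.prodMk hz.deriv.differentiableAt.hasDerivAt).deriv
  have hpair := eventuallyEq_of_deriv_eq (v := fun p : E × E ↦ (p.2, v p.1))
    (contDiffAt_snd.prodMk (hv.comp (f z₀, deriv f z₀) contDiffAt_fst))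
    (hf.prod hf.deriv) (hg.prod hg.deriv) (solves hf hdf) (solves hg hdg) (Prod.ext h₀ h₁)
  filter_upwards [hpair] with z hz using congrArg Prod.fst hz

end Uniqueness

section EnergyEquation

variable {f g P : ℂ → ℂ}

lemma eventuallyConst_of_deriv_eq_zero (hf : AnalyticAt ℂ f z₀)
    (hdf : ∀ᶠ z in 𝓝 z₀, deriv f z = 0) : EventuallyConst f (𝓝 z₀) :=
  eventuallyConst_iff_exists_eventuallyEq.mpr ⟨f z₀,
    eventuallyEq_of_deriv_eq (v := 0) contDiffAt_const hf analyticAt_const hdf (by simp) rfl⟩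

theorem deriv_deriv_eq_of_deriv_sq_eq (hP : AnalyticAt ℂ P (f z₀)) (hf : AnalyticAt ℂ f z₀)
    (hf_nc : ¬ EventuallyConst f (𝓝 z₀)) (hdf : ∀ᶠ z in 𝓝 z₀, deriv f z ^ 2 = P (f z)) :
    ∀ᶠ z in 𝓝 z₀, deriv (deriv f) z = deriv P (f z) / 2 := by
  have hmul : ∀ᶠ z in 𝓝 z₀, deriv f z * (2 * deriv (deriv f) z - deriv P (f z)) = 0 := by
    filter_upwards [hdf.eventually_nhds, hf.eventually_analyticAt,
      hf.continuousAt.eventually hP.eventually_analyticAt] with z hz hfz hPz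
    have hsq := hfz.deriv.differentiableAt.hasDerivAt.pow 2
    have hcomp := hPz.differentiableAt.hasDerivAt.comp z hfz.differentiableAt.hasDerivAt
    have := hsq.unique (hcomp.congr_of_eventuallyEq hz)
    push_cast at this
    linear_combination this
  have hne : ∀ᶠ z in 𝓝[≠] z₀, deriv f z ≠ 0 :=
    hf.deriv.eventually_eq_zero_or_eventually_ne_zero.resolve_left
      fun h ↦ hf_nc (eventuallyConst_of_deriv_eq_zero hf h)
  refine (hf.deriv.deriv.continuousAt.eventuallyEq_nhds_iff_eventuallyEq_nhdsNE
    ((hP.deriv.comp hf).continuousAt.div_const 2)).mp ?_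
  filter_upwards [hmul.filter_mono nhdsWithin_le_nhds, hne] with z hz hz'
  simp only [Function.comp_apply]
  linear_combination (mul_eq_zero.mp hz).resolve_left hz' / 2

theorem eventuallyEq_of_deriv_sq_eq (hP : AnalyticAt ℂ P (f z₀)) (hf : AnalyticAt ℂ f z₀)
    (hg : AnalyticAt ℂ g z₀) (hf_nc : ¬ EventuallyConst f (𝓝 z₀))
    (hg_nc : ¬ EventuallyConst g (𝓝 z₀)) (hdf : ∀ᶠ z in 𝓝 z₀, deriv f z ^ 2 = P (f z))
    (hdg : ∀ᶠ z in 𝓝 z₀, deriv g z ^ 2 = P (g z)) (h₀ : f z₀ = g z₀)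
    (h₁ : deriv f z₀ = deriv g z₀) : f =ᶠ[𝓝 z₀] g :=
  eventuallyEq_of_deriv_deriv_eq (v := fun w ↦ deriv P w / 2) (hP.deriv.div_const).contDiffAt
    hf hg (deriv_deriv_eq_of_deriv_sq_eq hP hf hf_nc hdf)
    (deriv_deriv_eq_of_deriv_sq_eq (h₀ ▸ hP) hg hg_nc hdg) h₀ h₁

-- At a double zero of `P` the constant function solves the same second order equation.
theorem deriv_ne_zero_of_deriv_sq_eq (hP : AnalyticAt ℂ P (f z₀)) (hf : AnalyticAt ℂ f z₀)
    (hf_nc : ¬ EventuallyConst f (𝓝 z₀)) (hdf : ∀ᶠ z in 𝓝 z₀, deriv f z ^ 2 = P (f z))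
    (h₁ : deriv f z₀ = 0) : deriv P (f z₀) ≠ 0 := by
  intro hP'
  refine hf_nc (eventuallyConst_iff_exists_eventuallyEq.mpr ⟨f z₀, ?_⟩)
  exact eventuallyEq_of_deriv_deriv_eq (v := fun w ↦ deriv P w / 2) (hP.deriv.div_const).contDiffAt
    hf analyticAt_const (deriv_deriv_eq_of_deriv_sq_eq hP hf hf_nc hdf) (by simp [hP']) rfl
    (by simpa using h₁)

end EnergyEquation

section Existence

variable {f F : ℂ → ℂ}

lemma exists_eventually_hasDerivAt (hf : AnalyticAt ℂ f z₀) (w : ℂ) :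
    ∃ G : ℂ → ℂ, G z₀ = w ∧ ∀ᶠ z in 𝓝 z₀, HasDerivAt G (f z) z := by
  obtain ⟨r, hr, hball⟩ := Metric.eventually_nhds_iff_ball.mp hf.eventually_analyticAt
  have hdiff : DifferentiableOn ℂ f (Metric.ball z₀ r) :=
    fun z hz ↦ (hball z hz).differentiableAt.differentiableWithinAt
  obtain ⟨G, hG₀, hG⟩ := hdiff.isExactOn_ball.with_val_at z₀ w
  exact ⟨G, hG₀, Metric.eventually_nhds_iff_ball.mpr ⟨r, hr, hG⟩⟩

variable (z₀) in
-- Separation of variables: the solution is the local inverse of a primitive of `1 / F`.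
theorem exists_eventually_hasDerivAt_comp {w₀ : ℂ} (hF : AnalyticAt ℂ F w₀) :
    ∃ f : ℂ → ℂ, f z₀ = w₀ ∧ ∀ᶠ z in 𝓝 z₀, HasDerivAt f (F (f z)) z := by
  by_cases hF₀ : F w₀ = 0
  · exact ⟨fun _ ↦ w₀, rfl, .of_forall fun z ↦ hF₀ ▸ hasDerivAt_const z w₀⟩
  obtain ⟨G, rfl, hG⟩ := exists_eventually_hasDerivAt (hF.inv hF₀) z₀
  have hGan : AnalyticAt ℂ G w₀ :=
    analyticAt_iff_eventually_differentiableAt.mpr (hG.mono fun _ h ↦ h.differentiableAt)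
  have hG' : deriv G w₀ ≠ 0 := by
    rw [hG.self_of_nhds.deriv]
    exact inv_ne_zero hF₀
  set f := hGan.hasStrictDerivAt.localInverse _ _ _ hG'
  have hf : AnalyticAt ℂ f (G w₀) := hGan.analyticAt_localInverse hG'
  have hf₀ : f (G w₀) = w₀ := HasStrictFDerivAt.localInverse_apply_image ..
  have hright : ∀ᶠ z in 𝓝 (G w₀), G (f z) = z := HasStrictDerivAt.eventually_right_inverse ..
  have hlim : Tendsto f (𝓝 (G w₀)) (𝓝 w₀) := by simpa [hf₀] using hf.continuousAt.tendsto
  refine ⟨f, hf₀, ?_⟩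
  filter_upwards [hf.eventually_analyticAt, hright.eventually_nhds, hlim.eventually hG,
    hlim.eventually (hF.continuousAt.eventually_ne hF₀)] with z hfz hrz hGz hFz
  simpa using HasDerivAt.of_local_left_inverse hfz.continuousAt hGz (inv_ne_zero hFz) hrz

end Existence

end HolomorphicODE

theorem exists_analyticAt_pow_eq {E : Type*} [NormedAddCommGroup E] [NormedSpace ℂ E] {f : E → ℂ}
    {x : E} (hf : AnalyticAt ℂ f x) (hfx : f x ≠ 0) {n : ℕ} (hn : n ≠ 0) {w : ℂ}
    (hw : w ^ n = f x) : ∃ g : E → ℂ, AnalyticAt ℂ g x ∧ g x = w ∧ ∀ y, g y ^ n = f y := by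
  refine ⟨fun y ↦ w * (f y / f x) ^ (n⁻¹ : ℂ), ?_, by simp [hfx], fun y ↦ ?_⟩
  · exact analyticAt_const.mul (hf.div_const.cpow analyticAt_const (by simp [hfx]))
  · rw [mul_pow, hw, cpow_nat_inv_pow _ hn, mul_div_cancel₀ _ hfx]

theorem eventuallyEq_nhdsNE_of_isPreconnected {𝕜 E : Type*} [NontriviallyNormedField 𝕜]
    [NormedAddCommGroup E] [NormedSpace 𝕜 E] {f g : 𝕜 → E} {U : Set 𝕜} {x y : 𝕜}
    (hf : MeromorphicOn f U) (hg : MeromorphicOn g U) (hU : IsPreconnected U) (hx : x ∈ U)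
    (hy : y ∈ U) (h : f =ᶠ[𝓝[≠] x] g) : f =ᶠ[𝓝[≠] y] g := by
  have htop {z : 𝕜} : meromorphicOrderAt (f - g) z = ⊤ ↔ f =ᶠ[𝓝[≠] z] g := by
    simp [meromorphicOrderAt_eq_top_iff, EventuallyEq, sub_eq_zero]
  rw [← htop] at h ⊢
  contrapose h
  exact (hf.sub hg).meromorphicOrderAt_ne_top_of_isPreconnected hU hy hx h

section Weierstrass

variable (L : PeriodPair)

lemma eventually_notMem_lattice (w : ℂ) : ∀ᶠ z in 𝓝[≠] w, z ∉ L.lattice := by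
  filter_upwards [self_mem_nhdsWithin, mem_nhdsWithin_of_mem_nhds
    (L.compl_lattice_sdiff_singleton_mem_nhds w)] with z hz hz'
  simp_all

lemma eventually_weierstrassP_ne {l : ℂ} (hl : l ∈ L.lattice) (a : ℂ) :
    ∀ᶠ z in 𝓝[≠] l, L.weierstrassP z ≠ a :=
  (tendsto_cobounded_of_meromorphicOrderAt_neg
    (by rw [L.order_weierstrassP l hl]; decide)).eventually_ne_cobounded a

lemma not_eventuallyConst_weierstrassP {w : ℂ} : ¬ EventuallyConst L.weierstrassP (𝓝[≠] w) := by
  intro h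
  obtain ⟨a, ha⟩ := eventuallyConst_iff_exists_eventuallyEq.mp h
  have ha₀ : L.weierstrassP =ᶠ[𝓝[≠] 0] fun _ ↦ a :=
    eventuallyEq_nhdsNE_of_isPreconnected (fun z _ ↦ L.meromorphic_weierstrassP z)
      (fun z _ ↦ .const a z) isPreconnected_univ (Set.mem_univ w) (Set.mem_univ 0) ha
  obtain ⟨z, hz, hz'⟩ := (ha₀.and (eventually_weierstrassP_ne L (zero_mem _) a)).exists
  exact hz' hz

lemma derivWeierstrassP_ω₁_div_two : L.derivWeierstrassP (L.ω₁ / 2) = 0 := by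
  have h := L.derivWeierstrassP_add_coe (-(L.ω₁ / 2)) ⟨L.ω₁, L.ω₁_mem_lattice⟩
  rw [neg_add_eq_sub, sub_half, L.derivWeierstrassP_neg] at h
  exact self_eq_neg.mp h

-- Otherwise `℘' ^ 2 = 4 * ℘ ^ 3`, and `℘ (ω₁ / 2)` is a multiple root of the right-hand side.
theorem g₂_ne_zero_of_g₃_eq_zero (h₃ : L.g₃ = 0) : L.g₂ ≠ 0 := by
  intro h₂
  have hode {z : ℂ} (hz : z ∉ L.lattice) :
      deriv L.weierstrassP z ^ 2 = 4 * L.weierstrassP z ^ 3 := by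
    simpa [h₂, h₃] using L.derivWeierstrassP_sq z hz
  have hw := L.ω₁_div_two_notMem_lattice
  have hw' : deriv L.weierstrassP (L.ω₁ / 2) = 0 := by simp [derivWeierstrassP_ω₁_div_two]
  have hPw : L.weierstrassP (L.ω₁ / 2) = 0 := by simpa [hw'] using hode hw
  refine deriv_ne_zero_of_deriv_sq_eq (P := fun x ↦ 4 * x ^ 3) (by fun_prop)
    (L.analyticOnNhd_weierstrassP _ hw)
    (fun h ↦ not_eventuallyConst_weierstrassP L (h.anti nhdsWithin_le_nhds))
    (by filter_upwards [L.isClosed_lattice.isOpen_compl.mem_nhds hw] with z hz using hode hz)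
    hw' (by simp [hPw])

lemma inv_weierstrassP_eq (z : ℂ) :
    (L.weierstrassP z)⁻¹ = z ^ 2 / (1 + z ^ 2 * L.weierstrassPExcept 0 z) := by
  rcases eq_or_ne z 0 with rfl | hz
  · simp
  have h := L.weierstrassPExcept_add 0 z
  simp only [ZeroMemClass.coe_zero, sub_zero] at h
  rw [← h]
  field_simp
  simp [add_comm]

lemma analyticAt_inv_weierstrassP_zero : AnalyticAt ℂ (fun z ↦ (L.weierstrassP z)⁻¹) 0 := by
  have := L.analyticAt_weierstrassPExcept 0
  simp only [inv_weierstrassP_eq]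
  exact AnalyticAt.div (by fun_prop) (by fun_prop) (by simp)

lemma not_eventuallyConst_inv_weierstrassP_zero :
    ¬ EventuallyConst (fun z ↦ (L.weierstrassP z)⁻¹) (𝓝 0) := fun h ↦
  not_eventuallyConst_weierstrassP L <| by
    simpa [Function.comp_def] using (h.comp (·⁻¹)).anti nhdsWithin_le_nhds

theorem eventually_deriv_inv_weierstrassP_sq :
    ∀ᶠ z in 𝓝 0, deriv (fun z ↦ (L.weierstrassP z)⁻¹) z ^ 2 =
      4 * (L.weierstrassP z)⁻¹ - L.g₂ * (L.weierstrassP z)⁻¹ ^ 3 -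
        L.g₃ * (L.weierstrassP z)⁻¹ ^ 4 := by
  have han := analyticAt_inv_weierstrassP_zero L
  have hcont := han.continuousAt
  refine ((han.deriv.pow 2).continuousAt.eventuallyEq_nhds_iff_eventuallyEq_nhdsNE
    (by fun_prop)).mp ?_
  filter_upwards [eventually_notMem_lattice L 0, eventually_weierstrassP_ne L (zero_mem _) 0]
    with z hzL hz
  have hd := (L.analyticOnNhd_weierstrassP z hzL).differentiableAt
  have hode := L.derivWeierstrassP_sq z hzL
  rw [Pi.pow_apply, deriv_fun_inv'' hd hz, L.deriv_weierstrassP]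
  field_simp
  linear_combination hode

theorem isElliptic_weierstrassQuotient : IsElliptic L (weierstrassQuotient L) where
  meromorphic := by
    have := L.meromorphic_weierstrassP
    unfold weierstrassQuotient
    fun_prop
  periodic l hl z := by
    simp only [weierstrassQuotient, L.weierstrassP_add_coe z ⟨l, hl⟩]

end Weierstrass

section Lattices

variable {L M : PeriodPair} {t : ℂ}

lemma G_eq_inv_pow_mul_G (ht : t ≠ 0) (h : ∀ z, t * z ∈ M.lattice ↔ z ∈ L.lattice) (n : ℕ) :
    M.G n = (t ^ n)⁻¹ * L.G n := by
  let e : L.lattice ≃ M.lattice := (Equiv.mulLeft₀ t ht).subtypeEquiv fun z ↦ (h z).symm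
  rw [PeriodPair.G, PeriodPair.G, ← e.tsum_eq, ← tsum_mul_left]
  refine tsum_congr fun l ↦ ?_
  rw [← mul_inv, ← mul_pow]
  rfl

lemma G_eq_zero_of_mul_mem_lattice_iff (ht : t ≠ 0) (h : ∀ z, t * z ∈ L.lattice ↔ z ∈ L.lattice)
    {n : ℕ} (htn : t ^ n ≠ 1) : L.G n = 0 := by
  have hG := G_eq_inv_pow_mul_G ht h n
  by_contra hne
  exact htn (inv_eq_one.mp (mul_eq_right₀ hne |>.mp hG.symm))

/-- The lattice `t Λ` similar to the lattice `Λ` of `L`; it serves to normalize `g₂`. -/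
noncomputable def scaledPeriodPair (L : PeriodPair) (ht : t ≠ 0) : PeriodPair where
  ω₁ := t * L.ω₁
  ω₂ := t * L.ω₂
  indep := by
    rw [LinearIndependent.pair_iff]
    intro a b hab
    refine LinearIndependent.pair_iff.mp L.indep a b (mul_left_cancel₀ ht ?_)
    simpa [mul_add, mul_left_comm t] using hab

lemma mul_mem_scaledPeriodPair_lattice_iff (ht : t ≠ 0) (z : ℂ) :
    t * z ∈ (scaledPeriodPair L ht).lattice ↔ z ∈ L.lattice := by
  simp only [PeriodPair.mem_lattice, scaledPeriodPair]
  exact exists₂_congr fun m n ↦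
    ⟨fun h ↦ mul_left_cancel₀ ht (by linear_combination h), fun h ↦ by linear_combination t * h⟩

theorem exists_g₂_eq_one (h₂ : L.g₂ ≠ 0) : ∃ M : PeriodPair, M.g₂ = 1 ∧ (L.g₃ = 0 → M.g₃ = 0) := by
  obtain ⟨t, ht⟩ := IsAlgClosed.exists_pow_nat_eq L.g₂ four_pos
  have ht₀ : t ≠ 0 := by
    rintro rfl
    exact h₂ (by simpa using ht.symm)
  have hG := G_eq_inv_pow_mul_G ht₀ (mul_mem_scaledPeriodPair_lattice_iff (L := L) ht₀)
  refine ⟨scaledPeriodPair L ht₀, ?_, fun h₃ ↦ ?_⟩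
  · rw [PeriodPair.g₂, hG, ht, mul_left_comm, ← PeriodPair.g₂, inv_mul_cancel₀ h₂]
  · rw [PeriodPair.g₃, hG, mul_left_comm, ← PeriodPair.g₃, h₃, mul_zero]

/-- The lattice `ℤ[i]` of Gaussian integers, whose invariance under multiplication by `i` makes
`g₃` vanish. -/
noncomputable def gaussianPeriodPair : PeriodPair where
  ω₁ := 1
  ω₂ := I
  indep := by simpa only [coe_basisOneI] using basisOneI.linearIndependent

lemma I_mul_mem_gaussianPeriodPair_lattice_iff (z : ℂ) :
    I * z ∈ gaussianPeriodPair.lattice ↔ z ∈ gaussianPeriodPair.lattice := by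
  simp only [PeriodPair.mem_lattice, gaussianPeriodPair]
  constructor
  · rintro ⟨m, n, h⟩
    refine ⟨n, -m, ?_⟩
    push_cast
    linear_combination (-I) * h + (n - z) * I_sq
  · rintro ⟨m, n, rfl⟩
    refine ⟨-n, m, ?_⟩
    push_cast
    linear_combination (-n : ℂ) * I_sq

theorem gaussianPeriodPair_g₃ : gaussianPeriodPair.g₃ = 0 := by
  have hI : I ^ 6 ≠ 1 := by
    rw [show I ^ 6 = -1 by linear_combination (I ^ 4 - I ^ 2 + 1) * I_sq]
    norm_num
  rw [PeriodPair.g₃, G_eq_zero_of_mul_mem_lattice_iff I_ne_zero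
    I_mul_mem_gaussianPeriodPair_lattice_iff hI, mul_zero]

theorem exists_g₂_eq_one_and_g₃_eq_zero : ∃ L : PeriodPair, L.g₂ = 1 ∧ L.g₃ = 0 := by
  obtain ⟨L, h₂, h₃⟩ := exists_g₂_eq_one (g₂_ne_zero_of_g₃_eq_zero _ gaussianPeriodPair_g₃)
  exact ⟨L, h₂, h₃ gaussianPeriodPair_g₃⟩

end Lattices

/-- Twice the stereographic coordinate of the point `(c ^ 2, s ^ 2)` of the circle
`x ^ 2 + y ^ 2 = 1`, projected from `(-1, 0)`; it is the counterpart of `1 / ℘`. -/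
noncomputable def stereographicCoord (s c : ℂ → ℂ) (z : ℂ) : ℂ :=
  2 * s z ^ 2 / (1 + c z ^ 2)

namespace IsSolutionIVP

-- The equation forces `c ^ 4 = 1 - s ^ 4`, which turns `s' = c ^ 3` into an equation for `s` alone.
theorem exists_ball :
    ∃ r : ℝ, 0 < r ∧ ∃ s c : ℂ → ℂ, IsSolutionIVP (Metric.ball 0 r) s c := by
  obtain ⟨k, hk, hk₀, hk_pow⟩ := exists_analyticAt_pow_eq (f := fun w : ℂ ↦ 1 - w ^ 4) (x := 0)
    (by fun_prop) (by simp) four_ne_zero (w := 1) (by simp)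
  obtain ⟨s, hs₀, hs⟩ := exists_eventually_hasDerivAt_comp 0 (hk.pow 3)
  have hlim : Tendsto s (𝓝 0) (𝓝 0) := by
    simpa [hs₀] using hs.self_of_nhds.continuousAt.tendsto
  have hk_deriv {w : ℂ} (hw : AnalyticAt ℂ k w) : k w ^ 3 * deriv k w = -w ^ 3 := by
    have hpow := hw.differentiableAt.hasDerivAt.fun_pow 4
    simp only [hk_pow] at hpow
    have := hpow.unique ((hasDerivAt_pow 4 w).const_sub 1)
    push_cast at this
    linear_combination this / 4
  obtain ⟨r, hr, hball⟩ := Metric.eventually_nhds_iff_ball.mp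
    (hs.and (hlim.eventually hk.eventually_analyticAt))
  refine ⟨r, hr, s, k ∘ s, Metric.isOpen_ball, Metric.mem_ball_self hr, fun z hz ↦ (hball z hz).1,
    fun z hz ↦ ?_, hs₀, by simp [hs₀, hk₀]⟩
  obtain ⟨hsz, hkz⟩ := hball z hz
  refine (hkz.differentiableAt.hasDerivAt.comp z hsz).congr_deriv ?_
  rw [Pi.pow_apply, mul_comm, hk_deriv hkz]

variable {U : Set ℂ} {s c : ℂ → ℂ}

lemma mem_nhds_zero (h : IsSolutionIVP U s c) : U ∈ 𝓝 0 :=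
  h.isOpen.mem_nhds h.zero_mem

lemma analyticOnNhd_s (h : IsSolutionIVP U s c) : AnalyticOnNhd ℂ s U :=
  DifferentiableOn.analyticOnNhd
    (fun z hz ↦ (h.hasDerivAt_s z hz).differentiableAt.differentiableWithinAt) h.isOpen

lemma analyticOnNhd_c (h : IsSolutionIVP U s c) : AnalyticOnNhd ℂ c U :=
  DifferentiableOn.analyticOnNhd
    (fun z hz ↦ (h.hasDerivAt_c z hz).differentiableAt.differentiableWithinAt) h.isOpen

theorem pow_four_add_pow_four (h : IsSolutionIVP U s c) (hU : IsPreconnected U) {z : ℂ}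
    (hz : z ∈ U) : s z ^ 4 + c z ^ 4 = 1 := by
  have hd (w : ℂ) (hw : w ∈ U) : HasDerivAt (fun z ↦ s z ^ 4 + c z ^ 4) 0 w := by
    refine (((h.hasDerivAt_s w hw).pow 4).add ((h.hasDerivAt_c w hw).pow 4)).congr_deriv ?_
    push_cast
    ring
  have hconst := h.isOpen.is_const_of_deriv_eq_zero hU
    (fun w hw ↦ (hd w hw).differentiableAt.differentiableWithinAt) (fun w hw ↦ (hd w hw).deriv)
    hz h.zero_mem
  simpa [h.s_zero, h.c_zero] using hconst

lemma eventually_one_add_sq_ne_zero (h : IsSolutionIVP U s c) : ∀ᶠ z in 𝓝 0, 1 + c z ^ 2 ≠ 0 := by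
  have hc := (h.analyticOnNhd_c 0 h.zero_mem).continuousAt
  refine ContinuousAt.eventually_ne (by fun_prop) ?_
  rw [h.c_zero]
  norm_num

lemma stereographicCoord_zero (h : IsSolutionIVP U s c) : stereographicCoord s c 0 = 0 := by
  simp [stereographicCoord, h.s_zero]

lemma analyticAt_stereographicCoord (h : IsSolutionIVP U s c) :
    AnalyticAt ℂ (stereographicCoord s c) 0 := by
  have hs := h.analyticOnNhd_s 0 h.zero_mem
  have hc := h.analyticOnNhd_c 0 h.zero_mem
  exact AnalyticAt.div (by fun_prop) (by fun_prop) h.eventually_one_add_sq_ne_zero.self_of_nhds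

lemma not_eventuallyConst_stereographicCoord (h : IsSolutionIVP U s c) :
    ¬ EventuallyConst (stereographicCoord s c) (𝓝 0) := by
  intro hconst
  have hs : s =ᶠ[𝓝 0] fun _ ↦ 0 := by
    obtain ⟨a, ha⟩ := eventuallyConst_iff_exists_eventuallyEq.mp hconst
    obtain rfl : 0 = a := h.stereographicCoord_zero.symm.trans ha.self_of_nhds
    filter_upwards [ha, h.eventually_one_add_sq_ne_zero] with z hz hne
    simpa [stereographicCoord, hne] using hz
  have hd := (h.hasDerivAt_s 0 h.zero_mem).deriv
  rw [hs.deriv_eq, deriv_const, h.c_zero] at hd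
  norm_num at hd

theorem eventually_deriv_stereographicCoord_sq (h : IsSolutionIVP U s c) (hU : IsPreconnected U) :
    ∀ᶠ z in 𝓝 0, deriv (stereographicCoord s c) z ^ 2 =
      4 * stereographicCoord s c z - stereographicCoord s c z ^ 3 := by
  filter_upwards [h.mem_nhds_zero, h.eventually_one_add_sq_ne_zero] with z hz hne
  have hcircle := h.pow_four_add_pow_four hU hz
  have hd : HasDerivAt (stereographicCoord s c) (4 * s z * c z / (1 + c z ^ 2)) z := by
    refine ((((h.hasDerivAt_s z hz).pow 2).const_mul 2).div
      (((h.hasDerivAt_c z hz).pow 2).const_add 1) hne).congr_deriv ?_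
    simp only [Pi.pow_apply]
    field_simp
    push_cast
    linear_combination 4 * s z * c z * hcircle
  rw [hd.deriv, stereographicCoord]
  field_simp
  linear_combination 8 * s z ^ 2 * hcircle

lemma sq_mul_four_add_stereographicCoord_sq (h : IsSolutionIVP U s c) (hU : IsPreconnected U)
    {z : ℂ} (hz : z ∈ U) (hne : 1 + c z ^ 2 ≠ 0) :
    c z ^ 2 * (4 + stereographicCoord s c z ^ 2) = 4 - stereographicCoord s c z ^ 2 := by
  rw [stereographicCoord]
  field_simp
  linear_combination 4 * (1 + c z ^ 2) * h.pow_four_add_pow_four hU hz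

variable {L : PeriodPair}

theorem eventually_inv_weierstrassP_eq_stereographicCoord (h : IsSolutionIVP U s c)
    (hU : IsPreconnected U) (h₂ : L.g₂ = 1) (h₃ : L.g₃ = 0) :
    (fun z ↦ (L.weierstrassP z)⁻¹) =ᶠ[𝓝 0] stereographicCoord s c := by
  have hP := eventually_deriv_inv_weierstrassP_sq L
  simp only [h₂, h₃, one_mul, zero_mul, sub_zero] at hP
  have hst := h.eventually_deriv_stereographicCoord_sq hU
  have hP' : deriv (fun z ↦ (L.weierstrassP z)⁻¹) 0 = 0 := by simpa using hP.self_of_nhds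
  have hst' : deriv (stereographicCoord s c) 0 = 0 := by
    simpa [h.stereographicCoord_zero] using hst.self_of_nhds
  exact eventuallyEq_of_deriv_sq_eq (P := fun x ↦ 4 * x - x ^ 3) (by fun_prop)
    (analyticAt_inv_weierstrassP_zero L) h.analyticAt_stereographicCoord
    (not_eventuallyConst_inv_weierstrassP_zero L) h.not_eventuallyConst_stereographicCoord
    hP hst (by simp [h.stereographicCoord_zero]) (hP'.trans hst'.symm)

theorem sq_mul_weierstrassP_sq_add (h : IsSolutionIVP U s c) (hU : IsPreconnected U)
    (h₂ : L.g₂ = 1) (h₃ : L.g₃ = 0) {z : ℂ} (hz : z ∈ U) (hzL : z ∉ L.lattice) :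
    c z ^ 2 * (L.weierstrassP z ^ 2 + 1 / 4) = L.weierstrassP z ^ 2 - 1 / 4 := by
  have hzero : (fun w ↦ c w ^ 2 * (L.weierstrassP w ^ 2 + 1 / 4)) =ᶠ[𝓝[≠] 0]
      fun w ↦ L.weierstrassP w ^ 2 - 1 / 4 := by
    filter_upwards [eventually_weierstrassP_ne L L.lattice.zero_mem 0,
      nhdsWithin_le_nhds h.mem_nhds_zero, nhdsWithin_le_nhds h.eventually_one_add_sq_ne_zero,
      nhdsWithin_le_nhds (h.eventually_inv_weierstrassP_eq_stereographicCoord hU h₂ h₃)]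
      with w hPw hw hne heq
    have hsq := h.sq_mul_four_add_stereographicCoord_sq hU hw hne
    rw [← heq] at hsq
    field_simp at hsq
    linear_combination hsq / 4
  have hmer := L.meromorphic_weierstrassP
  have hc (w : ℂ) (hw : w ∈ U) : MeromorphicAt c w := (h.analyticOnNhd_c w hw).meromorphicAt
  have hzU : (fun w ↦ c w ^ 2 * (L.weierstrassP w ^ 2 + 1 / 4)) =ᶠ[𝓝[≠] z]
      fun w ↦ L.weierstrassP w ^ 2 - 1 / 4 :=
    eventuallyEq_nhdsNE_of_isPreconnected
      (fun w hw ↦ by have := hc w hw; have := hmer w; fun_prop)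
      (fun w _ ↦ by have := hmer w; fun_prop) hU h.zero_mem hz hzero
  have hc_cont := (h.analyticOnNhd_c z hz).continuousAt
  have hP_cont := (L.analyticOnNhd_weierstrassP z hzL).continuousAt
  exact ((ContinuousAt.eventuallyEq_nhds_iff_eventuallyEq_nhdsNE (by fun_prop)
    (by fun_prop)).mp hzU).self_of_nhds

theorem weierstrassP_sq_add_ne_zero (h : IsSolutionIVP U s c) (hU : IsPreconnected U)
    (h₂ : L.g₂ = 1) (h₃ : L.g₃ = 0) {z : ℂ} (hz : z ∈ U) (hzL : z ∉ L.lattice) :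
    L.weierstrassP z ^ 2 + 1 / 4 ≠ 0 := by
  intro hzero
  have hmul := h.sq_mul_weierstrassP_sq_add hU h₂ h₃ hz hzL
  have hhalf : (1 / 2 : ℂ) = 0 := by linear_combination (1 - c z ^ 2) * hzero + hmul
  norm_num at hhalf

theorem sq_eq_weierstrassQuotient (h : IsSolutionIVP U s c) (hU : IsPreconnected U)
    (h₂ : L.g₂ = 1) (h₃ : L.g₃ = 0) {z : ℂ} (hz : z ∈ U) (hzL : z ∉ L.lattice) :
    c z ^ 2 = weierstrassQuotient L z :=
  eq_div_of_mul_eq (h.weierstrassP_sq_add_ne_zero hU h₂ h₃ hz hzL)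
    (h.sq_mul_weierstrassP_sq_add hU h₂ h₃ hz hzL)

theorem tendsto_weierstrassQuotient (h : IsSolutionIVP U s c) (hU : IsPreconnected U)
    (h₂ : L.g₂ = 1) (h₃ : L.g₃ = 0) {z : ℂ} (hz : z ∈ U) :
    Tendsto (weierstrassQuotient L) (𝓝[≠] z) (𝓝 (c z ^ 2)) := by
  have hc : Tendsto (fun w ↦ c w ^ 2) (𝓝[≠] z) (𝓝 (c z ^ 2)) :=
    ((h.analyticOnNhd_c z hz).continuousAt.pow 2).tendsto.mono_left nhdsWithin_le_nhds
  refine hc.congr' ?_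
  filter_upwards [eventually_notMem_lattice L z, nhdsWithin_le_nhds (h.isOpen.mem_nhds hz)]
    with w hwL hwU using h.sq_eq_weierstrassQuotient hU h₂ h₃ hwU hwL

end IsSolutionIVP

theorem theorem6 :
    -- the lemniscatic Weierstrass function exists
    (∃ L : PeriodPair, L.g₂ = 1 ∧ L.g₃ = 0) ∧
    -- the initial value problem is solvable near the origin
    (∃ r : ℝ, 0 < r ∧ ∃ s c : ℂ → ℂ, IsSolutionIVP (Metric.ball 0 r) s c) ∧
    ∀ L : PeriodPair, L.g₂ = 1 → L.g₃ = 0 →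
      IsElliptic L (weierstrassQuotient L) ∧
      ∀ (U : Set ℂ) (s c : ℂ → ℂ), IsPreconnected U → IsSolutionIVP U s c →
        -- equality at the points of `U` that are not poles of `℘`
        (∀ z ∈ U, z ∉ L.lattice →
          L.weierstrassP z ^ 2 + 1 / 4 ≠ 0 ∧
          c z ^ 2 = (L.weierstrassP z ^ 2 - 1 / 4) / (L.weierstrassP z ^ 2 + 1 / 4)) ∧
        -- at the poles of `℘` in `U` (such as `0`), equality after removing the singularity
        (∀ z ∈ U, z ∈ L.lattice →
          Filter.Tendsto (weierstrassQuotient L) (nhdsWithin z {z}ᶜ) (nhds (c z ^ 2))) := by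
  refine ⟨exists_g₂_eq_one_and_g₃_eq_zero, IsSolutionIVP.exists_ball, fun L h₂ h₃ ↦
    ⟨isElliptic_weierstrassQuotient L, fun U s c hU h ↦ ⟨fun z hz hzL ↦ ?_, fun z hz _ ↦ ?_⟩⟩⟩
  · exact ⟨h.weierstrassP_sq_add_ne_zero hU h₂ h₃ hz hzL,
      h.sq_eq_weierstrassQuotient hU h₂ h₃ hz hzL⟩
  · exact h.tendsto_weierstrassQuotient hU h₂ h₃ hz
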